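/- Let $G=(V,E)$ be a finite undirected graph without loops; parallel edges are allowed. For an orientation $D$ of $G$, $\varrho_D(v)$ is the number of arcs of $D$ with head $v$, and for $X\subseteq V$, $\varrho_D(X)$ is the number of arcs with head in $X$ and tail in $V\setminus X$; the in-degree vector of $D$ is $(\varrho_D(v))_{v\in V}$. $D$ is $k$-edge-connected if $\varrho_D(X)\ge k$ whenever $\emptyset\ne X\subsetneq V$. (a) Let $k\ge 0$ be an integer, let $f,g:V\to\mathbb Z$ with $f\le g$, and let $D$ be a $k$-edge-connected orientation of $G$ with $f(v)\le\varrho_D(v)\le g(v)$ for all $v\in V$. Then $D$ is decreasingly minimal among the $k$-edge-connected orientations $D'$ of $G$ satisfying $f\le\varrho_{D'}\le g$ (that is, the in-degree vector of $D$, rearranged in decreasing order, is lexicographically smaller than or equal to that of each such $D'$) if and only if there are no two nodes $s,t$ with $\varrho_D(t)\ge\varrho_D(s)+2$, $\varrho_D(t)>f(t)$, $\varrho_D(s)<g(s)$ for which $D$ contains $k+1$ pairwise arc-disjoint directed paths from $s$ to $t$. (b) Let $h:2^V\to\mathbb R_{\ge 0}$ satisfy $h(\emptyset)=h(V)=0$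 and be crossing supermodular, i.e. $h(X)+h(Y)\le h(X\cap Y)+h(X\cup Y)$ whenever $X\setminus Y$, $Y\setminus X$, $X\cap Y$ and $V\setminus(X\cup Y)$ are all non-empty. Let $i_G(X)$ be the number of edges of $G$ with both ends in $X$, and let $p:=h+i_G$. Then $p$ is crossing supermodular; an orientation $D$ of $G$ covers $h$ (i.e. $\varrho_D(X)\ge h(X)$ for all $X\subseteq V$) if and only if its in-degree vector belongs to $B'(p)=\{x\in\mathbb R^V:\ \sum_{v\in V}x(v)=p(V),\ \sum_{v\in X}x(v)\ge p(X)\text{ for all }X\subseteq V\}$; and the integral points of $B'(p)$ are exactly the in-degree vectors of the orientations of $G$ covering $h$. -/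

import Mathlib

open scoped Graph

/-- A directed multigraph with node type `V` and arc type `A` (parallel arcs are allowed). -/
structure MultiDigraph (V A : Type*) where
  /-- The tail (initial node) of an arc. -/
  tail : A → V
  /-- The head (terminal node) of an arc. -/
  head : A → V

namespace MultiDigraph

variable {V A : Type*}

/-- The in-degree of a node: the number of arcs with head `v`. -/
noncomputable def inDegree (D : MultiDigraph V A) (v : V) : ℤ :=
  ({a : A | D.head a = v}.ncard : ℤ)

/-- The in-degree of a set `X` of nodes: the number of arcs with head in `X` and tail outside. -/
noncomputable def setInDegree (D : MultiDigraph V A) (X : Finset V) : ℕ :=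
  {a : A | D.head a ∈ X ∧ D.tail a ∉ X}.ncard

/-- `D` is `k`-edge-connected if every non-empty proper subset of the node-set has in-degree
at least `k`. -/
def IsKEdgeConnected [Fintype V] (D : MultiDigraph V A) (k : ℕ) : Prop :=
  ∀ X : Finset V, X.Nonempty → X ≠ Finset.univ → k ≤ D.setInDegree X

/-- `D` covers the (finite-valued) set-function `h` if the in-degree of every set `X` of nodes
is at least `h X`. -/
def Covers (D : MultiDigraph V A) (h : Finset V → ℝ) : Prop :=
  ∀ X : Finset V, h X ≤ (D.setInDegree X : ℝ)

/-- `D.IsDiwalk s t P`: the list `P` is the sequence of arcs of a directed walk from `s` to `t`. -/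
def IsDiwalk (D : MultiDigraph V A) : V → V → List A → Prop
  | s, t, [] => s = t
  | s, t, a :: P => D.tail a = s ∧ D.IsDiwalk (D.head a) t P

/-- `D.IsDipath s t P`: the list `P` is the sequence of arcs of a directed path from `s` to `t`,
that is, of a directed walk that visits no node twice. -/
def IsDipath (D : MultiDigraph V A) (s t : V) (P : List A) : Prop :=
  D.IsDiwalk s t P ∧ (s :: P.map D.head).Nodup

/-- There are `n` pairwise arc-disjoint dipaths from `s` to `t`. -/
def HasArcDisjointDipaths (D : MultiDigraph V A) (n : ℕ) (s t : V) : Prop :=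
  ∃ P : Fin n → List A, (∀ i, D.IsDipath s t (P i)) ∧
    ∀ i j, i ≠ j → List.Disjoint (P i) (P j)

end MultiDigraph

section DecreasingMinimality

variable {V : Type*} [Fintype V]

/-- The components of `x` rearranged in decreasing order. -/
noncomputable def decSort (x : V → ℤ) : List ℤ :=
  (Finset.univ.val.map x).sort (· ≥ ·)

/-- `x` is decreasingly smaller than `y`: the decreasing rearrangement of `x` is
lexicographically smaller than that of `y`. -/
def DecSmaller (x y : V → ℤ) : Prop :=
  List.Lex (· < ·) (decSort x) (decSort y)

/-- `x` and `y` are value-equivalent. -/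
def ValueEquivalent (x y : V → ℤ) : Prop :=
  decSort x = decSort y

/-- `x` is a decreasingly minimal element of the set `Q` of vectors. -/
def IsDecMin (Q : Set (V → ℤ)) (x : V → ℤ) : Prop :=
  x ∈ Q ∧ ∀ y ∈ Q, DecSmaller x y ∨ ValueEquivalent x y

end DecreasingMinimality

section SetFunctions

variable {V : Type*} [Fintype V]

/-- Two sets of nodes are crossing if none of `X - Y`, `Y - X`, `X ∩ Y` and `V - (X ∪ Y)`
is empty. -/
def Crossing [DecidableEq V] (X Y : Finset V) : Prop :=
  (X \ Y).Nonempty ∧ (Y \ X).Nonempty ∧ (X ∩ Y).Nonempty ∧ (X ∪ Y)ᶜ.Nonempty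

/-- The supermodular inequality holds for all crossing pairs. -/
def IsCrossingSupermodular [DecidableEq V] (p : Finset V → ℝ) : Prop :=
  ∀ X Y : Finset V, Crossing X Y → p X + p Y ≤ p (X ∩ Y) + p (X ∪ Y)

/-- The polyhedron `B'(p) = {x : x(V) = p(V), x(X) ≥ p(X) for every X ⊆ V}`. -/
def basePolyhedron (p : Finset V → ℝ) : Set (V → ℝ) :=
  {x | ∑ v, x v = p Finset.univ ∧ ∀ X : Finset V, p X ≤ ∑ v ∈ X, x v}

end SetFunctions

namespace Graph

variable {α β : Type*}

/-- The number `i_G(X)` of edges of `G` induced by `X` (all of whose ends lie in `X`). -/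
noncomputable def inducedEdgeCount (G : Graph α β) (X : Finset V(G)) : ℕ :=
  {e : E(G) | ∀ v : V(G), G.Inc e v → v ∈ X}.ncard

/-- The digraph `D`, having the nodes of `G` as its nodes and one arc for each edge of `G`, is an
orientation of `G`: the arc of each edge leads from one end of the edge to the other. -/
def IsOrientation (G : Graph α β) (D : MultiDigraph V(G) E(G)) : Prop :=
  ∀ e : E(G), G.IsLink e (D.tail e) (D.head e)

/-- `D` is a `k`-edge-connected orientation of `G` with `f(v) ≤ ϱ(v) ≤ g(v)` for every node. -/
def IsConstrainedOrientation (G : Graph α β) [Fintype V(G)] (k : ℕ) (f g : V(G) → ℤ)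
    (D : MultiDigraph V(G) E(G)) : Prop :=
  G.IsOrientation D ∧ D.IsKEdgeConnected k ∧ ∀ v, f v ≤ D.inDegree v ∧ D.inDegree v ≤ g v

/-- `D` is a decreasingly minimal `k`-edge-connected and in-degree constrained orientation of `G`:
its in-degree vector is decreasingly minimal among the in-degree vectors of all
`k`-edge-connected orientations of `G` respecting the bounds `f` and `g`. -/
def IsDecMinConstrainedOrientation (G : Graph α β) [Fintype V(G)] (k : ℕ) (f g : V(G) → ℤ)
    (D : MultiDigraph V(G) E(G)) : Prop :=
  G.IsConstrainedOrientation k f g D ∧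
    IsDecMin {m | ∃ D', G.IsConstrainedOrientation k f g D' ∧ m = D'.inDegree} D.inDegree

end Graph

/-- Sorted lists are compared by their largest element of differing multiplicity. -/
theorem List.lex_lt_of_count_lt (β : ℤ) (l₁ l₂ : List ℤ) (h₁ : l₁.Pairwise (· ≥ ·))
    (h₂ : l₂.Pairwise (· ≥ ·)) (heq : ∀ c, β < c → l₁.count c = l₂.count c)
    (hlt : l₁.count β < l₂.count β) : List.Lex (· < ·) l₁ l₂ := by
  induction l₂ generalizing l₁ with
  | nil => simp at hlt
  | cons b l₂ ih =>
    cases l₁ with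
    | nil => exact List.Lex.nil
    | cons a l₁ =>
      rw [List.pairwise_cons] at h₁ h₂
      rcases lt_trichotomy a b with hab | rfl | hab
      · exact List.Lex.rel hab
      · refine List.Lex.cons (ih l₁ h₁.2 h₂.2 (fun c hc => ?_) ?_)
        · have := heq c hc
          simp only [List.count_cons] at this
          omega
        · simp only [List.count_cons] at hlt
          omega
      · exfalso
        have hzero : ∀ c, b < c → (b :: l₂).count c = 0 := by
          intro c hc
          rw [List.count_eq_zero, List.mem_cons]
          rintro (rfl | hm)
          · exact lt_irrefl _ hc
          · exact absurd (h₂.1 c hm) (not_le.mpr hc)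
        rcases lt_or_ge β a with ha | ha
        · have h := heq a ha
          rw [hzero a hab] at h
          simp at h
        · rw [hzero β (lt_of_lt_of_le hab ha)] at hlt
          omega

/-! ### Decreasing rearrangement under unit moves -/

section DecSort

variable {V : Type*} [Fintype V]

theorem pairwise_decSort (x : V → ℤ) : (decSort x).Pairwise (· ≥ ·) :=
  Multiset.pairwise_sort _ _

theorem count_decSort (x : V → ℤ) (c : ℤ) :
    (decSort x).count c = (Finset.univ.filter (fun v => x v = c)).card := by
  rw [← Multiset.coe_count, decSort, Multiset.sort_eq, Multiset.count_map]
  simp only [eq_comm]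
  rfl

variable [DecidableEq V]

/-- The vector obtained from `x` by moving one unit from `t` to `s`. -/
def moveUnit (x : V → ℤ) (s t : V) : V → ℤ :=
  fun v => x v - (if v = t then 1 else 0) + (if v = s then 1 else 0)

theorem decSmaller_moveUnit {x : V → ℤ} {s t : V} (h : x s + 2 ≤ x t) :
    DecSmaller (moveUnit x s t) x := by
  have hst : s ≠ t := by rintro rfl; omega
  -- Both new values lie below `x t`: that value loses the occurrence at `t`, and larger values are
  -- untouched.
  refine List.lex_lt_of_count_lt (x t) _ _ (pairwise_decSort _) (pairwise_decSort _) ?_ ?_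
  · intro c hc
    rw [count_decSort, count_decSort]
    congr 1
    ext v
    simp only [Finset.mem_filter, Finset.mem_univ, true_and]
    simp only [moveUnit]
    by_cases h1 : v = t <;> by_cases h2 : v = s
    · subst h1; exact absurd h2.symm hst
    · subst h1; simp [h2]; omega
    · subst h2; simp [h1]; omega
    · simp [h1, h2]
  · rw [count_decSort, count_decSort]
    refine Finset.card_lt_card (Finset.ssubset_iff_of_subset ?_ |>.mpr ⟨t, ?_⟩)
    · intro v
      simp only [Finset.mem_filter, Finset.mem_univ, true_and]
      simp only [moveUnit]
      by_cases h1 : v = t <;> by_cases h2 : v = s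
      · subst h1; exact absurd h2.symm hst
      · subst h1; simp
      · subst h2; simp [h1]; omega
      · simp [h1, h2]
    · refine ⟨Finset.mem_filter.mpr ⟨Finset.mem_univ _, rfl⟩, fun ht => ?_⟩
      replace ht := (Finset.mem_filter.mp ht).2
      simp [moveUnit, hst.symm] at ht

/-- With gap exactly one, the move merely swaps the two values. -/
theorem decSort_moveUnit {x : V → ℤ} {s t : V} (h : x t = x s + 1) :
    decSort (moveUnit x s t) = decSort x := by
  have hst : s ≠ t := by rintro rfl; omega
  have hx : moveUnit x s t = x ∘ Equiv.swap s t := by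
    funext v
    simp only [moveUnit, Function.comp]
    by_cases h1 : v = t
    · subst h1; simp [hst.symm]; omega
    · by_cases h2 : v = s
      · subst h2; simp [h1]; omega
      · simp [h1, h2, Equiv.swap_apply_of_ne_of_ne h2 h1]
  unfold decSort
  congr 1
  rw [hx, ← Multiset.map_map]
  congr 1
  exact congrArg Finset.val (Finset.map_univ_equiv (Equiv.swap s t))

theorem sum_abs_moveUnit_sub_lt {x y : V → ℤ} {s t : V} (hs : x s < y s) (ht : y t < x t) :
    ∑ v, |moveUnit x s t v - y v| < ∑ v, |x v - y v| := by
  have hst : s ≠ t := by rintro rfl; omega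
  refine Finset.sum_lt_sum (fun v _ => ?_) ⟨t, Finset.mem_univ _, ?_⟩
  · simp only [moveUnit]
    by_cases h1 : v = t
    · subst h1
      simp only [if_true, if_neg hst.symm]
      rw [abs_of_nonneg (by omega), abs_of_nonneg (by omega)]; omega
    · by_cases h2 : v = s
      · subst h2
        simp only [if_true, if_neg h1]
        rw [abs_of_nonpos (by omega), abs_of_nonpos (by omega)]; omega
      · simp [h1, h2]
  · simp only [moveUnit, if_true, if_neg hst.symm]
    rw [abs_of_nonneg (by omega), abs_of_nonneg (by omega)]; omega

end DecSort

/-- If a family closed under unions of intersecting members has non-negative weights, then the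
union of its members has non-negative weight. -/
theorem Finset.sum_biUnion_nonneg_of_union_closed {V : Type*} [DecidableEq V]
    (P : Finset V → Prop) (w : V → ℤ)
    (hP : ∀ A B, P A → P B → ¬ Disjoint A B → P (A ∪ B)) (hw : ∀ A, P A → 0 ≤ ∑ v ∈ A, w v)
    (S : Finset (Finset V)) (hS : ∀ A ∈ S, P A) : 0 ≤ ∑ v ∈ S.biUnion id, w v := by
  induction hn : S.card using Nat.strong_induction_on generalizing S with
  | _ n ih =>
    by_cases hd : (S : Set (Finset V)).PairwiseDisjoint id
    · rw [Finset.sum_biUnion hd]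
      exact Finset.sum_nonneg fun A hA => hw A (hS A hA)
    · have : ∃ A ∈ S, ∃ B ∈ S, A ≠ B ∧ ¬ Disjoint A B := by
        by_contra hcon
        push Not at hcon
        exact hd fun A hA B hB hAB => hcon A hA B hB hAB
      obtain ⟨A, hA, B, hB, hAB, hdis⟩ := this
      -- Merging two intersecting members keeps the union and shrinks the family; a disjoint family
      -- is eventually reached.
      have hBe : B ∈ S.erase A := Finset.mem_erase.mpr ⟨hAB.symm, hB⟩
      have hcard : (insert (A ∪ B) ((S.erase A).erase B)).card < n := by
        have h1 := Finset.card_insert_le (A ∪ B) ((S.erase A).erase B)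
        have h2 := Finset.card_erase_add_one hBe
        have h3 := Finset.card_erase_add_one hA
        omega
      have hU : (insert (A ∪ B) ((S.erase A).erase B)).biUnion id = S.biUnion id := by
        conv_rhs => rw [← Finset.insert_erase hA, ← Finset.insert_erase hBe]
        simp only [Finset.biUnion_insert, id, Finset.union_assoc]
      rw [← hU]
      refine ih _ hcard _ (fun C hC => ?_) rfl
      rcases Finset.mem_insert.mp hC with rfl | hC
      · exact hP _ _ (hS A hA) (hS B hB) hdis
      · exact hS C (Finset.mem_of_mem_erase (Finset.mem_of_mem_erase hC))

namespace MultiDigraph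

variable {V A : Type*}

/-- The number of arcs induced by `X`. -/
noncomputable def inducedArcCount (D : MultiDigraph V A) (X : Finset V) : ℕ :=
  {a : A | D.tail a ∈ X ∧ D.head a ∈ X}.ncard

/-- Two digraphs are orientations of the same undirected graph. -/
def IsReorientation (D D' : MultiDigraph V A) : Prop :=
  ∀ a, (D'.tail a = D.tail a ∧ D'.head a = D.head a) ∨
    (D'.tail a = D.head a ∧ D'.head a = D.tail a)

theorem IsReorientation.inducedArcCount_eq {D D' : MultiDigraph V A} (h : D.IsReorientation D')
    (X : Finset V) : D'.inducedArcCount X = D.inducedArcCount X := by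
  unfold inducedArcCount
  congr 1
  ext a
  rcases h a with ⟨h1, h2⟩ | ⟨h1, h2⟩ <;> simp [h1, h2, and_comm]

theorem IsReorientation.refl (D : MultiDigraph V A) : D.IsReorientation D :=
  fun _ => Or.inl ⟨rfl, rfl⟩

theorem IsReorientation.symm {D D' : MultiDigraph V A} (h : D.IsReorientation D') :
    D'.IsReorientation D := by
  intro a
  rcases h a with ⟨h1, h2⟩ | ⟨h1, h2⟩ <;> simp [h1, h2]

theorem IsReorientation.trans {D D' D'' : MultiDigraph V A} (h : D.IsReorientation D')
    (h' : D'.IsReorientation D'') : D.IsReorientation D'' := by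
  intro a
  rcases h a with ⟨h1, h2⟩ | ⟨h1, h2⟩ <;> rcases h' a with ⟨h3, h4⟩ | ⟨h3, h4⟩ <;>
    simp [h1, h2, h3, h4]

/-! ### Cut in-degrees and the exchange property -/

section Degrees

theorem setInDegree_univ [Fintype V] (D : MultiDigraph V A) : D.setInDegree Finset.univ = 0 := by
  simp [setInDegree]

variable [Finite A] [DecidableEq V]

theorem sum_inDegree (D : MultiDigraph V A) (X : Finset V) :
    ∑ v ∈ X, D.inDegree v = D.setInDegree X + D.inducedArcCount X := by
  have h1 : ∑ v ∈ X, D.inDegree v = ({a : A | D.head a ∈ X}.ncard : ℤ) := by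
    induction X using Finset.induction_on with
    | empty => simp
    | insert v X hv ih =>
      rw [Finset.sum_insert hv, ih, inDegree, ← Nat.cast_add, ← Set.ncard_union_eq]
      · congr 2
        ext a
        simp
      · rw [Set.disjoint_left]
        rintro a rfl ha
        exact hv ha
  rw [h1, setInDegree, inducedArcCount, ← Nat.cast_add, ← Set.ncard_union_eq]
  · congr 2
    ext a
    simp only [Set.mem_ofPred_eq, Set.mem_union]
    tauto
  · rw [Set.disjoint_left]
    rintro a ⟨_, ha⟩ ⟨hb, _⟩
    exact ha hb

/-- Induced arc counts cancel, so the in-degree vectors alone determine the change of every cut. -/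
theorem IsReorientation.setInDegree_sub {D D' : MultiDigraph V A} (h : D.IsReorientation D')
    (X : Finset V) : (D'.setInDegree X : ℤ) - D.setInDegree X =
      ∑ v ∈ X, (D'.inDegree v - D.inDegree v) := by
  rw [Finset.sum_sub_distrib, sum_inDegree, sum_inDegree, h.inducedArcCount_eq]
  ring

theorem setInDegree_submodular (D : MultiDigraph V A) (X Y : Finset V) :
    D.setInDegree (X ∩ Y) + D.setInDegree (X ∪ Y) ≤ D.setInDegree X + D.setInDegree Y := by
  unfold setInDegree
  rw [← Set.ncard_union_add_ncard_inter {a : A | D.head a ∈ X ∩ Y ∧ D.tail a ∉ X ∩ Y},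
    ← Set.ncard_union_add_ncard_inter {a : A | D.head a ∈ X ∧ D.tail a ∉ X}]
  refine add_le_add (Set.ncard_le_ncard ?_) (Set.ncard_le_ncard ?_) <;>
  · intro a
    simp only [Set.mem_union, Set.mem_inter_iff, Set.mem_ofPred_eq, Finset.mem_inter,
      Finset.mem_union]
    tauto

theorem IsReorientation.setInDegree_of_moveUnit {D D' : MultiDigraph V A}
    (h : D.IsReorientation D') {j : ℤ} {s t : V}
    (hd : ∀ v, D'.inDegree v = D.inDegree v - (if v = t then j else 0) + (if v = s then j else 0))
    (X : Finset V) : (D'.setInDegree X : ℤ) =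
      D.setInDegree X - (if t ∈ X then j else 0) + (if s ∈ X then j else 0) := by
  have h1 := h.setInDegree_sub X
  have h2 : ∑ v ∈ X, (D'.inDegree v - D.inDegree v) =
      ∑ v ∈ X, (if v = s then j else 0) - ∑ v ∈ X, (if v = t then j else 0) := by
    rw [← Finset.sum_sub_distrib]
    exact Finset.sum_congr rfl fun v _ => by rw [hd]; ring
  rw [h2, Finset.sum_ite_eq', Finset.sum_ite_eq'] at h1
  linarith

/-- One-sided exchange: among the nodes whose in-degree is smaller in `D` than in `D'`, there is
one that is separated from `u` by no tight set. -/
theorem exists_exchange [Fintype V] {D D' : MultiDigraph V A} {k : ℕ}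
    (h : D.IsReorientation D') (hD : D.IsKEdgeConnected k) (hD' : D'.IsKEdgeConnected k) {u : V}
    (hu : D'.inDegree u < D.inDegree u) :
    ∃ v, D.inDegree v < D'.inDegree v ∧
      ∀ X : Finset V, u ∈ X → v ∉ X → k + 1 ≤ D.setInDegree X := by
  classical
  -- Complements of the tight sets containing `u`. Submodularity makes them closed under union when
  -- they intersect.
  let P : Finset V → Prop := fun C => C.Nonempty ∧ u ∉ C ∧ D.setInDegree Cᶜ = k
  let w : V → ℤ := fun v => D.inDegree v - D'.inDegree v
  have hw0 : ∑ v, w v = 0 := by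
    have := h.symm.setInDegree_sub Finset.univ
    simp only [setInDegree_univ] at this
    simpa [w] using this.symm
  have hP : ∀ B C, P B → P C → ¬ Disjoint B C → P (B ∪ C) := by
    rintro B C ⟨hB, huB, hkB⟩ ⟨hC, huC, hkC⟩ hd
    refine ⟨hB.mono Finset.subset_union_left, by simp [huB, huC], ?_⟩
    have h1 := D.setInDegree_submodular Bᶜ Cᶜ
    have h2 : k ≤ D.setInDegree (Bᶜ ∩ Cᶜ) := by
      refine hD _ ⟨u, by simp [huB, huC]⟩ fun hh => ?_
      obtain ⟨x, hx⟩ := hB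
      have := Finset.mem_univ x
      rw [← hh] at this
      simp [hx] at this
    have h3 : k ≤ D.setInDegree (Bᶜ ∪ Cᶜ) := by
      refine hD _ ⟨u, by simp [huB]⟩ fun hh => ?_
      obtain ⟨x, hxB, hxC⟩ := Finset.not_disjoint_iff.mp hd
      have := Finset.mem_univ x
      rw [← hh] at this
      simp [hxB, hxC] at this
    rw [Finset.compl_union]
    omega
  have hw : ∀ C, P C → 0 ≤ ∑ v ∈ C, w v := by
    rintro C ⟨⟨x, hx⟩, huC, hkC⟩
    have h1 : k ≤ D'.setInDegree Cᶜ := by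
      refine hD' _ ⟨u, by simp [huC]⟩ fun hh => ?_
      have := Finset.mem_univ x
      rw [← hh] at this
      simp [hx] at this
    have h2 := h.symm.setInDegree_sub Cᶜ
    have h3 := Finset.sum_add_sum_compl C w
    -- The cut `Cᶜ` equals `k` in `D` and is at least `k` in `D'`.
    have h4 : ∑ v ∈ Cᶜ, w v ≤ 0 := by
      change (_ : ℤ) = ∑ v ∈ Cᶜ, w v at h2
      omega
    omega
  let W := (Finset.univ.filter P).biUnion id
  have hW : 0 ≤ ∑ v ∈ W, w v :=
    Finset.sum_biUnion_nonneg_of_union_closed P w hP hw _ fun C hC => (Finset.mem_filter.mp hC).2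
  have hmem : ∀ v, v ∈ W ↔ ∃ C, P C ∧ v ∈ C := by simp [W]
  have huW : u ∉ W := by
    rw [hmem]
    rintro ⟨C, hC, huC⟩
    exact hC.2.1 huC
  -- The total weight is zero and `W` has non-negative weight, so the positive weight of `u` outside
  -- `W` must be compensated outside `W`.
  have hv : ∃ v ∈ Wᶜ, w v < 0 := by
    by_contra hcon
    push Not at hcon
    have h1 : 0 < ∑ v ∈ Wᶜ, w v :=
      Finset.sum_pos' hcon ⟨u, Finset.mem_compl.mpr huW, sub_pos.mpr hu⟩
    have := Finset.sum_add_sum_compl W w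
    omega
  obtain ⟨v, hvW, hv⟩ := hv
  refine ⟨v, sub_neg.mp hv, fun X huX hvX => ?_⟩
  have hk := hD X ⟨u, huX⟩ (by rintro rfl; simp at hvX)
  by_contra hcon
  refine Finset.mem_compl.mp hvW ((hmem v).mpr ⟨Xᶜ, ⟨⟨v, by simpa using hvX⟩, by simpa using huX, ?_⟩,
    by simpa using hvX⟩)
  rw [compl_compl]
  omega

end Degrees

/-! ### Path reversal and Menger's theorem -/

section Paths

theorem IsDiwalk.congr {D D' : MultiDigraph V A} {s t : V} {P : List A} (h : D.IsDiwalk s t P)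
    (hP : ∀ a ∈ P, D'.tail a = D.tail a ∧ D'.head a = D.head a) : D'.IsDiwalk s t P := by
  induction P generalizing s with
  | nil => exact h
  | cons a P ih =>
    obtain ⟨h1, h2⟩ := h
    obtain ⟨h3, h4⟩ := hP a List.mem_cons_self
    exact ⟨h3.trans h1, by rw [h4]; exact ih h2 fun b hb => hP b (List.mem_cons_of_mem _ hb)⟩

theorem IsDipath.congr {D D' : MultiDigraph V A} {s t : V} {P : List A} (h : D.IsDipath s t P)
    (hP : ∀ a ∈ P, D'.tail a = D.tail a ∧ D'.head a = D.head a) : D'.IsDipath s t P := by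
  refine ⟨h.1.congr hP, ?_⟩
  rw [List.map_congr_left fun a ha => (hP a ha).2]
  exact h.2

theorem IsDipath.nodup {D : MultiDigraph V A} {s t : V} {P : List A} (h : D.IsDipath s t P) :
    P.Nodup :=
  (List.nodup_cons.mp h.2).2.of_map

theorem IsDipath.exists_suffix {D : MultiDigraph V A} {s t v : V} {P : List A}
    (h : D.IsDipath s t P) (hv : v ∈ s :: P.map D.head) :
    ∃ Q, D.IsDipath v t Q ∧ ∀ a ∈ Q, a ∈ P := by
  induction P generalizing s with
  | nil =>
    obtain rfl : v = s := by simpa using hv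
    exact ⟨[], h, fun _ => id⟩
  | cons a P ih =>
    rcases List.mem_cons.mp hv with rfl | hv
    · exact ⟨a :: P, h, fun _ => id⟩
    · obtain ⟨Q, hQ, hQP⟩ := ih ⟨h.1.2, (List.nodup_cons.mp h.2).2⟩ hv
      exact ⟨Q, hQ, fun b hb => List.mem_cons_of_mem _ (hQP b hb)⟩

theorem IsDiwalk.exists_entering {D : MultiDigraph V A} {s t : V} {P : List A}
    (h : D.IsDiwalk s t P) {X : Finset V} (hs : s ∉ X) (ht : t ∈ X) :
    ∃ a ∈ P, D.head a ∈ X ∧ D.tail a ∉ X := by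
  induction P generalizing s with
  | nil => exact absurd (h ▸ ht) hs
  | cons a P ih =>
    by_cases ha : D.head a ∈ X
    · exact ⟨a, List.mem_cons_self, ha, h.1 ▸ hs⟩
    · obtain ⟨b, hb, hb'⟩ := ih h.2 ha
      exact ⟨b, List.mem_cons_of_mem _ hb, hb'⟩

theorem HasArcDisjointDipaths.le_setInDegree [Finite A] {D : MultiDigraph V A} {n : ℕ} {s t : V}
    (h : D.HasArcDisjointDipaths n s t) {X : Finset V} (hs : s ∉ X) (ht : t ∈ X) :
    n ≤ D.setInDegree X := by
  obtain ⟨P, hP, hd⟩ := h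
  choose a haP ha using fun i => (hP i).1.exists_entering hs ht
  have hinj : Function.Injective a := by
    intro i j hij
    by_contra hne
    exact hd i j hne (haP i) (hij ▸ haP j)
  have h1 : (Set.range a).ncard = n := by
    rw [← Set.image_univ, Set.ncard_image_of_injective _ hinj, Set.ncard_univ, Nat.card_fin]
  rw [← h1]
  refine Set.ncard_le_ncard ?_
  rintro _ ⟨i, rfl⟩
  exact ha i

theorem exists_isDipath_of_cuts [Fintype V] {D : MultiDigraph V A} {s t : V} {S : A → Prop}
    (h : ∀ X : Finset V, t ∈ X → s ∉ X → ∃ a, S a ∧ D.head a ∈ X ∧ D.tail a ∉ X) :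
    ∃ P, D.IsDipath s t P ∧ ∀ a ∈ P, S a := by
  classical
  let R : Finset V := Finset.univ.filter fun v => ∃ P, D.IsDipath v t P ∧ ∀ a ∈ P, S a
  have hR : ∀ v, v ∈ R ↔ ∃ P, D.IsDipath v t P ∧ ∀ a ∈ P, S a := by simp [R]
  rw [← hR]
  by_contra hs
  obtain ⟨a, haS, hah, hat⟩ := h R ((hR t).mpr ⟨[], ⟨rfl, by simp⟩, by simp⟩) hs
  obtain ⟨P, hP, hPS⟩ := (hR _).mp hah
  -- If the tail is already on the path, a suffix suffices; otherwise the arc can be prepended.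
  by_cases hmem : D.tail a ∈ D.head a :: P.map D.head
  · obtain ⟨Q, hQ, hQP⟩ := hP.exists_suffix hmem
    exact hat ((hR _).mpr ⟨Q, hQ, fun b hb => hPS b (hQP b hb)⟩)
  · refine hat ((hR _).mpr ⟨a :: P, ⟨⟨rfl, hP.1⟩, ?_⟩, ?_⟩)
    · exact List.nodup_cons.mpr ⟨hmem, hP.2⟩
    · intro b hb
      rcases List.mem_cons.mp hb with rfl | hb
      · exact haS
      · exact hPS b hb

open Classical in
/-- The digraph obtained by reversing the arcs in `P`. -/
noncomputable def reverse (D : MultiDigraph V A) (P : List A) : MultiDigraph V A where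
  tail a := if a ∈ P then D.head a else D.tail a
  head a := if a ∈ P then D.tail a else D.head a

theorem isReorientation_reverse (D : MultiDigraph V A) (P : List A) :
    D.IsReorientation (D.reverse P) := by
  intro a
  by_cases ha : a ∈ P <;> simp [reverse, ha]

theorem reverse_nil (D : MultiDigraph V A) : D.reverse [] = D := by
  simp [reverse]

variable [Finite A] [DecidableEq V]

theorem inDegree_reverse_cons (D : MultiDigraph V A) {a : A} {P : List A} (ha : a ∉ P) (v : V) :
    (D.reverse (a :: P)).inDegree v = (D.reverse P).inDegree v - (if v = D.head a then 1 else 0) +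
      (if v = D.tail a then 1 else 0) := by
  have key : ∀ (E : MultiDigraph V A), E.inDegree v =
      ({b : A | b ≠ a ∧ E.head b = v}.ncard : ℤ) + (if v = E.head a then 1 else 0) := by
    intro E
    unfold inDegree
    split_ifs with h
    · have : {b : A | E.head b = v} = insert a {b : A | b ≠ a ∧ E.head b = v} := by
        ext b
        by_cases hb : b = a
        · subst hb; simp [h]
        · simp [hb]
      rw [this, Set.ncard_insert_of_notMem (by simp)]
      simp
    · have : {b : A | E.head b = v} = {b : A | b ≠ a ∧ E.head b = v} := by
        ext b
        by_cases hb : b = a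
        · subst hb; simp [eq_comm, h]
        · simp [hb]
      rw [this]
      simp
  rw [key (D.reverse (a :: P)), key (D.reverse P)]
  have h1 : {b : A | b ≠ a ∧ (D.reverse (a :: P)).head b = v} =
      {b : A | b ≠ a ∧ (D.reverse P).head b = v} := by
    ext b
    by_cases hb : b = a
    · simp [hb]
    · have : (D.reverse (a :: P)).head b = (D.reverse P).head b := by
        by_cases hbP : b ∈ P
        · exact (if_pos (List.mem_cons_of_mem _ hbP)).trans (if_pos hbP).symm
        · exact (if_neg (by simp [hb, hbP])).trans (if_neg hbP).symm
      rw [Set.mem_ofPred_eq, Set.mem_ofPred_eq, this]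
  have h2 : (D.reverse (a :: P)).head a = D.tail a := by simp [reverse]
  have h3 : (D.reverse P).head a = D.head a := by simp [reverse, ha]
  rw [h1, h2, h3]
  ring

/-- Each reversed arc moves a unit from its head to its tail, and this telescopes along the walk.
Distinctness of arcs matters because reversal depends only on membership in `P`. -/
theorem IsDiwalk.inDegree_reverse {D : MultiDigraph V A} {s t : V} {P : List A}
    (h : D.IsDiwalk s t P) (hP : P.Nodup) : (D.reverse P).inDegree = moveUnit D.inDegree s t := by
  funext v
  induction P generalizing s with
  | nil =>
    obtain rfl : s = t := h
    simp [reverse_nil, moveUnit]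
  | cons a P ih =>
    rw [List.nodup_cons] at hP
    rw [inDegree_reverse_cons D hP.1, ih h.2 hP.2, ← h.1]
    simp only [moveUnit]
    ring

variable [Fintype V]

/-- A flow decomposition: the arcs on which `D` and `D'` differ carry `j` units from `s` to `t`.
Reversing one path among them brings `D` closer to `D'` and leaves `j - 1` units. -/
theorem exists_arcDisjoint_of_reorientation {D D' : MultiDigraph V A} {s t : V}
    (h : D.IsReorientation D') (j : ℕ)
    (hd : ∀ v, D'.inDegree v =
      D.inDegree v - (if v = t then (j : ℤ) else 0) + (if v = s then (j : ℤ) else 0)) :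
    ∃ P : Fin j → List A, (∀ i, D.IsDipath s t (P i)) ∧
      (∀ i i', i ≠ i' → List.Disjoint (P i) (P i')) ∧
      ∀ i, ∀ a ∈ P i, D'.head a ≠ D.head a := by
  induction j generalizing D with
  | zero => exact ⟨Fin.elim0, fun i => i.elim0, fun i => i.elim0, fun i => i.elim0⟩
  | succ j ih =>
    have hcut : ∀ X : Finset V, t ∈ X → s ∉ X →
        ∃ a, D'.head a ≠ D.head a ∧ D.head a ∈ X ∧ D.tail a ∉ X := by
      intro X ht hs
      by_contra hcon
      push Not at hcon
      have h1 := h.setInDegree_of_moveUnit hd X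
      have h2 : D.setInDegree X ≤ D'.setInDegree X := by
        refine Set.ncard_le_ncard ?_
        rintro a ⟨ha1, ha2⟩
        have ha3 : D'.head a = D.head a := by
          by_contra hne
          exact ha2 (hcon a hne ha1)
        rcases h a with ⟨h4, h5⟩ | ⟨h4, h5⟩
        · exact ⟨h5 ▸ ha1, h4 ▸ ha2⟩
        · exact absurd (h5.symm.trans ha3 ▸ ha1) ha2
      rw [if_pos ht, if_neg hs] at h1
      push_cast at h1
      omega
    obtain ⟨Q, hQ, hQS⟩ := exists_isDipath_of_cuts hcut
    have hagree : ∀ a ∈ Q, D'.head a = (D.reverse Q).head a := by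
      intro a ha
      rcases h a with ⟨_, h2⟩ | ⟨_, h2⟩
      · exact absurd h2 (hQS a ha)
      · simp [reverse, ha, h2]
    obtain ⟨P, hP, hPd, hPS⟩ := ih (D := D.reverse Q)
      ((isReorientation_reverse D Q).symm.trans h) (by
        intro v
        rw [hd v, hQ.1.inDegree_reverse hQ.nodup, moveUnit]
        push_cast
        split_ifs <;> ring)
    -- On `Q` the reversed digraph already agrees with `D'`, so the later paths avoid `Q` and are
    -- paths of `D` itself.
    have hPQ : ∀ i, ∀ a ∈ P i, a ∉ Q := fun i a ha haQ => hPS i a ha (hagree a haQ)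
    refine ⟨Fin.cons Q P, ?_, ?_, ?_⟩
    · intro i
      refine Fin.cases ?_ (fun i => ?_) i
      · exact hQ
      · refine (hP i).congr fun a ha => ?_
        simp [reverse, hPQ i a ha]
    · intro i i'
      refine Fin.cases ?_ (fun i => ?_) i <;> refine Fin.cases ?_ (fun i' => ?_) i'
      · exact fun hne => absurd rfl hne
      · exact fun _ a ha ha' => hPQ i' a ha' ha
      · exact fun _ a ha ha' => hPQ i a ha ha'
      · exact fun hne => hPd i i' fun hh => hne (by rw [hh])
    · intro i
      refine Fin.cases ?_ (fun i => ?_) i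
      · exact hQS
      · intro a ha
        have := hPS i a ha
        simpa [reverse, hPQ i a ha] using this

/-- Menger's theorem, arc-disjoint directed version. -/
theorem hasArcDisjointDipaths_of_cuts {D : MultiDigraph V A} {s t : V} (n : ℕ)
    (h : ∀ X : Finset V, t ∈ X → s ∉ X → n ≤ D.setInDegree X) : D.HasArcDisjointDipaths n s t := by
  -- Augmentation: after `j < n` reversals every relevant cut still has in-degree at least `n - j >
  -- 0`, so another path exists.
  have hex : ∀ j ≤ n, ∃ D' : MultiDigraph V A, D.IsReorientation D' ∧ ∀ v, D'.inDegree v =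
      D.inDegree v - (if v = t then (j : ℤ) else 0) + (if v = s then (j : ℤ) else 0) := by
    intro j
    induction j with
    | zero => exact fun _ => ⟨D, IsReorientation.refl D, by simp⟩
    | succ j ih =>
      intro hj
      obtain ⟨D', hD', hd⟩ := ih (by omega)
      obtain ⟨P, hP, -⟩ := exists_isDipath_of_cuts (D := D') (s := s) (t := t)
        (S := fun _ => True) (by
          intro X ht hs
          have h1 := hD'.setInDegree_of_moveUnit hd X
          have h2 := h X ht hs
          rw [if_pos ht, if_neg hs] at h1
          have h3 : D'.setInDegree X ≠ 0 := by omega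
          obtain ⟨a, ha⟩ := Set.nonempty_of_ncard_ne_zero h3
          exact ⟨a, trivial, ha⟩)
      refine ⟨D'.reverse P, hD'.trans (isReorientation_reverse D' P), fun v => ?_⟩
      rw [hP.1.inDegree_reverse hP.nodup, moveUnit, hd v]
      push_cast
      split_ifs <;> ring
  obtain ⟨D', hD', hd⟩ := hex n le_rfl
  obtain ⟨P, hP, hPd, -⟩ := exists_arcDisjoint_of_reorientation hD' n hd
  exact ⟨P, hP, hPd⟩

/-- If every cut separating `t` from `s` exceeds `k`, then a unit of in-degree can be moved from
`t` to `s` while preserving `k`-edge-connectivity. -/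
theorem exists_reorientation_moveUnit {D : MultiDigraph V A} {k : ℕ} (hD : D.IsKEdgeConnected k)
    {s t : V} (h : ∀ X : Finset V, t ∈ X → s ∉ X → k + 1 ≤ D.setInDegree X) :
    ∃ D' : MultiDigraph V A, D.IsReorientation D' ∧ D'.IsKEdgeConnected k ∧
      D'.inDegree = moveUnit D.inDegree s t := by
  obtain ⟨P, hP, -⟩ := exists_isDipath_of_cuts (D := D) (s := s) (t := t)
    (S := fun _ => True) (by
      intro X ht hs
      have h2 := h X ht hs
      have h3 : D.setInDegree X ≠ 0 := by omega
      obtain ⟨a, ha⟩ := Set.nonempty_of_ncard_ne_zero h3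
      exact ⟨a, trivial, ha⟩)
  have hr := isReorientation_reverse D P
  have hd := hP.1.inDegree_reverse hP.nodup
  refine ⟨D.reverse P, hr, fun X hX hX' => ?_, hd⟩
  have h1 := hr.setInDegree_of_moveUnit (j := 1) (fun v => congrFun hd v) X
  have h2 := hD X hX hX'
  by_cases ht : t ∈ X <;> by_cases hs : s ∈ X
  · rw [if_pos ht, if_pos hs] at h1; omega
  · have := h X ht hs
    rw [if_pos ht, if_neg hs] at h1; omega
  · rw [if_neg ht, if_pos hs] at h1; omega
  · rw [if_neg ht, if_neg hs] at h1; omega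

end Paths

end MultiDigraph

namespace Graph

open MultiDigraph

variable {α β : Type*} {G : Graph α β}

theorem IsOrientation.isReorientation {D D' : MultiDigraph V(G) E(G)} (h : G.IsOrientation D)
    (h' : G.IsOrientation D') : D.IsReorientation D' := by
  intro e
  rcases (h' e).eq_and_eq_or_eq_and_eq (h e) with ⟨h1, h2⟩ | ⟨h1, h2⟩
  · exact Or.inl ⟨Subtype.ext h1, Subtype.ext h2⟩
  · exact Or.inr ⟨Subtype.ext h1, Subtype.ext h2⟩

theorem IsOrientation.of_isReorientation {D D' : MultiDigraph V(G) E(G)} (h : G.IsOrientation D)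
    (h' : D.IsReorientation D') : G.IsOrientation D' := by
  intro e
  rcases h' e with ⟨h1, h2⟩ | ⟨h1, h2⟩
  · rw [h1, h2]; exact h e
  · rw [h1, h2]; exact (h e).symm

theorem IsOrientation.inducedEdgeCount_eq {D : MultiDigraph V(G) E(G)} (h : G.IsOrientation D)
    (X : Finset V(G)) : G.inducedEdgeCount X = D.inducedArcCount X := by
  unfold inducedEdgeCount inducedArcCount
  congr 1
  ext e
  constructor
  · exact fun he => ⟨he _ (h e).inc_left, he _ (h e).inc_right⟩
  · rintro ⟨h1, h2⟩ v hv
    rcases hv.eq_or_eq_of_isLink (h e) with hv | hv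
    · rw [Subtype.ext hv]; exact h1
    · rw [Subtype.ext hv]; exact h2

/-! ### Local optimality implies decreasing minimality -/

section DecMin

variable [DecidableEq α] [Fintype V(G)] [Finite E(G)] {k : ℕ} {f g : V(G) → ℤ}
  {D : MultiDigraph V(G) E(G)}

theorem IsConstrainedOrientation.exists_moveUnit (hD : G.IsConstrainedOrientation k f g D)
    {s t : V(G)} (hst : s ≠ t) (ht : f t < D.inDegree t) (hs : D.inDegree s < g s)
    (h : ∀ X : Finset V(G), t ∈ X → s ∉ X → k + 1 ≤ D.setInDegree X) :
    ∃ D', G.IsConstrainedOrientation k f g D' ∧ D'.inDegree = moveUnit D.inDegree s t := by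
  obtain ⟨D', hr, hk, hd⟩ := exists_reorientation_moveUnit hD.2.1 h
  refine ⟨D', ⟨hD.1.of_isReorientation hr, hk, fun v => ?_⟩, hd⟩
  have hv := hD.2.2 v
  rw [hd, moveUnit]
  by_cases h1 : v = t
  · subst h1
    simp only [if_true, if_neg hst.symm]
    omega
  · by_cases h2 : v = s
    · subst h2
      simp only [if_true, if_neg h1]
      omega
    · simpa [h1, h2] using hv

theorem IsConstrainedOrientation.not_decSmaller (hD : G.IsConstrainedOrientation k f g D)
    (hopt : ¬ ∃ s t : V(G), D.inDegree t ≥ D.inDegree s + 2 ∧ D.inDegree t > f t ∧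
      D.inDegree s < g s ∧ D.HasArcDisjointDipaths (k + 1) s t)
    {D' : MultiDigraph V(G) E(G)} (hD' : G.IsConstrainedOrientation k f g D') :
    ¬ DecSmaller D'.inDegree D.inDegree := by
  induction hn : (∑ v, |D'.inDegree v - D.inDegree v|).toNat using Nat.strong_induction_on
    generalizing D' with
  | _ n ih =>
    intro hlt
    have hr := hD.1.isReorientation hD'.1
    have hne : D'.inDegree ≠ D.inDegree := by
      intro hh
      rw [hh] at hlt
      exact lt_irrefl (decSort D.inDegree) hlt
    have hex : ∃ u, D'.inDegree u < D.inDegree u := by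
      by_contra hcon
      push Not at hcon
      have h1 := hr.setInDegree_sub Finset.univ
      simp only [setInDegree_univ, sub_self] at h1
      have h2 := (Finset.sum_eq_zero_iff_of_nonneg
        fun v _ => sub_nonneg.mpr (hcon v)).mp h1.symm
      exact hne (funext fun v => sub_eq_zero.mp (h2 v (Finset.mem_univ v)))
    obtain ⟨u, hu, hmax⟩ := Finset.exists_max_image
      (Finset.univ.filter fun u => D'.inDegree u < D.inDegree u) D.inDegree
      (by obtain ⟨u, hu⟩ := hex; exact ⟨u, by simpa using hu⟩)
    replace hu : D'.inDegree u < D.inDegree u := by simpa using hu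
    replace hmax : ∀ x, D'.inDegree x < D.inDegree x → D.inDegree x ≤ D.inDegree u :=
      fun x hx => hmax x (by simpa using hx)
    -- The values of `D'` at `u` and `v` witness that the bounds leave room there, so a gap of two
    -- in `D` would contradict `hopt`.
    obtain ⟨v, hv, hcut⟩ := exists_exchange hr hD.2.1 hD'.2.1 hu
    have hle : D.inDegree u ≤ D.inDegree v + 1 := by
      by_contra hcon
      refine hopt ⟨v, u, by omega, ?_, ?_, ?_⟩
      · have := (hD'.2.2 u).1; omega
      · have := (hD'.2.2 v).2; omega
      · exact hasArcDisjointDipaths_of_cuts _ hcut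
    obtain ⟨w, hw, hcut'⟩ := exists_exchange hr.symm hD'.2.1 hD.2.1 hv
    have hwu := hmax w hw
    obtain ⟨D'', hD'', hd⟩ := hD'.exists_moveUnit (s := w) (t := v) (by rintro rfl; omega)
      (by have := (hD.2.2 v).1; omega) (by have := (hD.2.2 w).2; omega) hcut'
    have hdist := sum_abs_moveUnit_sub_lt hw hv
    rw [← hd] at hdist
    refine ih _ ?_ hD'' rfl ?_
    · have : 0 ≤ ∑ v, |D''.inDegree v - D.inDegree v| :=
        Finset.sum_nonneg fun _ _ => abs_nonneg _
      omega
    · rw [hd]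
      -- By the choice of `u`: `D'(w) + 1 ≤ D(w) ≤ D(u) ≤ D(v) + 1 ≤ D'(v)`. Gap one permutes the
      -- values; a larger gap strictly improves.
      rcases (show D'.inDegree w + 1 ≤ D'.inDegree v by omega).eq_or_lt with heq | hlt'
      · rw [DecSmaller, decSort_moveUnit heq.symm]
        exact hlt
      · exact lt_trans (a := decSort (moveUnit D'.inDegree w v)) (b := decSort D'.inDegree)
          (decSmaller_moveUnit (by omega)) hlt

theorem IsConstrainedOrientation.isDecMin_iff (hD : G.IsConstrainedOrientation k f g D) :
    G.IsDecMinConstrainedOrientation k f g D ↔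
      ¬ ∃ s t : V(G), D.inDegree t ≥ D.inDegree s + 2 ∧ D.inDegree t > f t ∧
        D.inDegree s < g s ∧ D.HasArcDisjointDipaths (k + 1) s t := by
  constructor
  · rintro ⟨-, -, hmin⟩ ⟨s, t, hts, ht, hs, hP⟩
    obtain ⟨D', hD', hd⟩ := hD.exists_moveUnit (by rintro rfl; omega) ht hs
      fun X htX hsX => hP.le_setInDegree hsX htX
    have hlt : decSort D'.inDegree < decSort D.inDegree := by
      rw [hd]
      exact decSmaller_moveUnit hts
    rcases hmin _ ⟨D', hD', rfl⟩ with h | h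
    · exact lt_asymm hlt h
    · exact hlt.ne h.symm
  · intro hopt
    refine ⟨hD, ⟨D, hD, rfl⟩, ?_⟩
    rintro _ ⟨D', hD', rfl⟩
    rcases lt_trichotomy (decSort D.inDegree) (decSort D'.inDegree) with h | h | h
    · exact Or.inl h
    · exact Or.inr h
    · exact absurd h (hD.not_decSmaller hopt hD')

end DecMin

theorem inducedEdgeCount_univ [Fintype V(G)] :
    G.inducedEdgeCount Finset.univ = Nat.card E(G) := by
  simp [inducedEdgeCount]

/-! ### Orientations covering `h` and the base polyhedron -/

section Covering

variable [DecidableEq α] [Finite E(G)]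

theorem inducedEdgeCount_supermodular (X Y : Finset V(G)) :
    G.inducedEdgeCount X + G.inducedEdgeCount Y ≤
      G.inducedEdgeCount (X ∩ Y) + G.inducedEdgeCount (X ∪ Y) := by
  unfold inducedEdgeCount
  rw [← Set.ncard_inter_add_ncard_union]
  refine add_le_add (Set.ncard_le_ncard ?_) (Set.ncard_le_ncard ?_)
  · rintro e ⟨h1, h2⟩ v hv
    exact Finset.mem_inter.mpr ⟨h1 v hv, h2 v hv⟩
  · rintro e (h | h) v hv
    · exact Finset.mem_union_left _ (h v hv)
    · exact Finset.mem_union_right _ (h v hv)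

variable [Fintype V(G)]

theorem IsOrientation.covers_iff {D : MultiDigraph V(G) E(G)} (hD : G.IsOrientation D)
    {h : Finset V(G) → ℝ} (huniv : h Finset.univ = 0) :
    D.Covers h ↔ (fun v => (D.inDegree v : ℝ)) ∈
      basePolyhedron (fun X => h X + (G.inducedEdgeCount X : ℝ)) := by
  have hsum : ∀ X : Finset V(G), ∑ v ∈ X, (D.inDegree v : ℝ) =
      D.setInDegree X + G.inducedEdgeCount X := by
    intro X
    rw [hD.inducedEdgeCount_eq]
    exact_mod_cast D.sum_inDegree X
  constructor
  · refine fun hc => ⟨?_, fun X => ?_⟩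
    · simp only [hsum, setInDegree_univ, huniv, Nat.cast_zero]
    · rw [hsum]
      exact add_le_add_left (hc X) _
  · rintro ⟨-, hX⟩ X
    have := hX X
    rw [hsum] at this
    exact le_of_add_le_add_right this

/-- Hakimi's theorem: a vector is the in-degree vector of an orientation if it has total `|E|` and
majorizes `i_G`. -/
theorem exists_isOrientation_inDegree_eq (m : V(G) → ℤ) (htot : ∑ v, m v = Nat.card E(G))
    (hm : ∀ X : Finset V(G), (G.inducedEdgeCount X : ℤ) ≤ ∑ v ∈ X, m v) :
    ∃ D : MultiDigraph V(G) E(G), G.IsOrientation D ∧ D.inDegree = m := by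
  classical
  have := Fintype.ofFinite E(G)
  have hpos : ∀ v, 0 ≤ m v := fun v => by
    have := hm {v}
    rw [Finset.sum_singleton] at this
    omega
  -- Each node `v` offers `m v` slots, and an edge may take any slot at one of its ends, which
  -- becomes its head.
  let N : E(G) → Finset (Σ v : V(G), Fin (m v).toNat) :=
    fun e => Finset.univ.filter fun c => G.Inc e c.1
  have hall : ∀ F : Finset E(G), F.card ≤ (F.biUnion N).card := by
    intro F
    let X : Finset V(G) := Finset.univ.filter fun v => ∃ e ∈ F, G.Inc e v
    have h1 : F.biUnion N = X.sigma fun v => Finset.univ := by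
      ext c
      simp [N, X]
    have h2 : ((F.biUnion N).card : ℤ) = ∑ v ∈ X, m v := by
      rw [h1, Finset.card_sigma]
      simp [hpos]
    -- Hall's condition: `F` is induced by the set `X` of its ends, and `X` offers at least that
    -- many slots.
    have h3 : F.card ≤ G.inducedEdgeCount X := by
      rw [← Set.ncard_coe_finset]
      refine Set.ncard_le_ncard fun e he v hv => ?_
      simp only [X, Finset.mem_filter, Finset.mem_univ, true_and]
      exact ⟨e, he, hv⟩
    have := hm X
    omega
  obtain ⟨c, hinj, hc⟩ := (Finset.all_card_le_biUnion_card_iff_exists_injective N).mp hall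
  -- The total of `m` is the number of edges, so all slots are filled and the in-degrees equal `m`
  -- exactly.
  have hcard : Fintype.card E(G) = Fintype.card (Σ v : V(G), Fin (m v).toNat) := by
    have : (Fintype.card (Σ v : V(G), Fin (m v).toNat) : ℤ) = Nat.card E(G) := by
      rw [Fintype.card_sigma, ← htot]
      simp [hpos]
    rw [Nat.card_eq_fintype_card] at this
    exact_mod_cast this.symm
  have hbij : Function.Bijective c := (Fintype.bijective_iff_injective_and_card c).mpr ⟨hinj, hcard⟩
  have hinc : ∀ e : E(G), ∃ x : V(G), G.IsLink e x (c e).1 := by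
    intro e
    obtain ⟨y, hy⟩ : G.Inc e (c e).1 := by simpa [N] using hc e
    exact ⟨⟨y, hy.right_mem⟩, hy.symm⟩
  choose x hx using hinc
  refine ⟨⟨x, fun e => (c e).1⟩, hx, funext fun v => ?_⟩
  unfold inDegree
  have h1 : {e : E(G) | (c e).1 = v}.ncard =
      ({d : Σ v : V(G), Fin (m v).toNat | d.1 = v} : Set _).ncard := by
    rw [← Set.ncard_image_of_injective {e : E(G) | (c e).1 = v} hinj]
    congr 1
    ext d
    obtain ⟨e, rfl⟩ := hbij.2 d
    simp [hinj.eq_iff]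
  have h2 : ({d : Σ v : V(G), Fin (m v).toNat | d.1 = v} : Set _) =
      Set.range (Sigma.mk v) := by
    ext ⟨a, b⟩
    constructor
    · rintro rfl
      exact ⟨b, rfl⟩
    · rintro ⟨b', hb'⟩
      exact (congrArg Sigma.fst hb').symm
  change (({e : E(G) | (c e).1 = v}.ncard : ℕ) : ℤ) = m v
  rw [h1, h2, ← Set.image_univ, Set.ncard_image_of_injective _ sigma_mk_injective, Set.ncard_univ,
    Nat.card_fin, Int.toNat_of_nonneg (hpos v)]

end Covering

end Graph

theorem mainTheorem9 {α β : Type*} [DecidableEq α] (G : Graph α β) [G.Loopless]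
    [Fintype V(G)] [Finite E(G)] :
    (∀ (k : ℕ) (f g : V(G) → ℤ), (∀ v, f v ≤ g v) →
      ∀ D : MultiDigraph V(G) E(G), G.IsConstrainedOrientation k f g D →
        (G.IsDecMinConstrainedOrientation k f g D ↔
          ¬ ∃ s t : V(G), D.inDegree t ≥ D.inDegree s + 2 ∧ D.inDegree t > f t ∧
            D.inDegree s < g s ∧ D.HasArcDisjointDipaths (k + 1) s t)) ∧
    (∀ h : Finset V(G) → ℝ, (∀ X, 0 ≤ h X) → h ∅ = 0 → h Finset.univ = 0 →
      IsCrossingSupermodular h →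
        IsCrossingSupermodular (fun X => h X + (G.inducedEdgeCount X : ℝ)) ∧
        (∀ D : MultiDigraph V(G) E(G), G.IsOrientation D →
          (D.Covers h ↔ (fun v => (D.inDegree v : ℝ)) ∈
            basePolyhedron (fun X => h X + (G.inducedEdgeCount X : ℝ)))) ∧
        {m : V(G) → ℤ | (fun v => (m v : ℝ)) ∈
            basePolyhedron (fun X => h X + (G.inducedEdgeCount X : ℝ))} =
          {m : V(G) → ℤ | ∃ D : MultiDigraph V(G) E(G),
            G.IsOrientation D ∧ D.Covers h ∧ m = D.inDegree}) := by
  refine ⟨fun k f g _ D hD => hD.isDecMin_iff, fun h hpos _ huniv hh => ⟨?_, ?_, ?_⟩⟩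
  · intro X Y hXY
    have h1 := hh X Y hXY
    have h2 : (G.inducedEdgeCount X : ℝ) + G.inducedEdgeCount Y ≤
        G.inducedEdgeCount (X ∩ Y) + G.inducedEdgeCount (X ∪ Y) := by
      exact_mod_cast Graph.inducedEdgeCount_supermodular X Y
    simp only
    linarith
  · exact fun D hD => hD.covers_iff huniv
  · ext m
    constructor
    · intro hm
      obtain ⟨D, hD, rfl⟩ := Graph.exists_isOrientation_inDegree_eq m
        (by
          have h1 := hm.1
          simp only [huniv, zero_add, Graph.inducedEdgeCount_univ] at h1
          exact_mod_cast h1)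
        (by
          intro X
          have h1 := hm.2 X
          have h2 : (G.inducedEdgeCount X : ℝ) ≤ ∑ v ∈ X, (m v : ℝ) := by
            have := hpos X
            simp only at h1
            linarith
          exact_mod_cast h2)
      exact ⟨D, hD, (hD.covers_iff huniv).mpr hm, rfl⟩
    · rintro ⟨D, hD, hc, rfl⟩
      exact (hD.covers_iff huniv).mp hc
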